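/- All C*-algebras are unital, and C*-subalgebras and extensions are unital (they share the unit). For a C*-algebra $A$, let $A^{**}$ be its double dual with its usual C*-algebra structure, i.e. the enveloping von Neumann algebra $\pi_u(A)''$ of $A$, where $\pi_u$ is the universal representation of $A$ (the direct sum of the GNS representations of all states of $A$); $A$ is canonically embedded in $A^{**}$. If $A$ is a C*-subalgebra of a C*-algebra $B$, then $A$ is called relatively weakly injective in $B$ if there is a unital completely positive map $\phi : B \to A^{**}$ such that $\phi(a) = a$ for all $a \in A$. A C*-algebra $A$ has the weak expectation property (WEP) if it is relatively weakly injective in every C*-algebra $B$ containing it as a C*-subalgebra. **Proposition.** Let $A$ be a nonseparable C*-algebra, and let $\mathcal{C}$ be a collection of separable C*-subalgebras of $A$ such that every $C \in \mathcal{C}$ has WEP and such that $\mathcal{C}$ is cofinal, i.e. every separable C*-subalgebra of $A$ is contained in some $C \in \mathcal{C}$. Then $A$ has WEP. -/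

import Mathlib

open scoped ComplexOrder ENNReal

universe u v

noncomputable section

namespace CStarWEP

section Bicommutant

variable {A H : Type*} [CStarAlgebra A] [NormedAddCommGroup H] [InnerProductSpace ℂ H]
  [CompleteSpace H]

/-- The double commutant `π(A)''` of the image of a representation `π` of `A` on a Hilbert space
`H`, that is, the von Neumann algebra generated by `π(A)`. -/
def bicommutant (π : A →⋆ₐ[ℂ] (H →L[ℂ] H)) : StarSubalgebra ℂ (H →L[ℂ] H) :=
  StarSubalgebra.centralizer ℂ
    (StarSubalgebra.centralizer ℂ (Set.range π) : Set (H →L[ℂ] H))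

instance bicommutant_isClosed (π : A →⋆ₐ[ℂ] (H →L[ℂ] H)) :
    IsClosed (bicommutant π : Set (H →L[ℂ] H)) := by
  rw [bicommutant, StarSubalgebra.coe_centralizer]
  exact Set.isClosed_centralizer _

/-- The von Neumann algebra `π(A)''` is a C⋆-algebra, as a norm-closed ⋆-subalgebra of the bounded
operators. -/
instance bicommutantCStarAlgebra (π : A →⋆ₐ[ℂ] (H →L[ℂ] H)) : CStarAlgebra (bicommutant π) :=
  StarSubalgebra.cstarAlgebra (bicommutant π)

theorem mem_bicommutant (π : A →⋆ₐ[ℂ] (H →L[ℂ] H)) (a : A) : π a ∈ bicommutant π := by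
  rw [bicommutant, StarSubalgebra.mem_centralizer_iff]
  intro g hg
  have hg' := (StarSubalgebra.mem_centralizer_iff ℂ).mp hg (π a) ⟨a, rfl⟩
  have hs := (StarSubalgebra.mem_centralizer_iff ℂ).mp
    (star_mem (s := StarSubalgebra.centralizer ℂ (Set.range π)) hg) (π a) ⟨a, rfl⟩
  exact ⟨hg'.1.symm, hs.1.symm⟩

/-- The representation `π`, as a ⋆-homomorphism from `A` into `π(A)''`. -/
def toBicommutant (π : A →⋆ₐ[ℂ] (H →L[ℂ] H)) : A →⋆ₐ[ℂ] bicommutant π :=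
  π.codRestrict (bicommutant π) (mem_bicommutant π)

end Bicommutant

section Bidual

variable (A : Type u) [CStarAlgebra A] [PartialOrder A] [StarOrderedRing A]

/-- The states of a unital C⋆-algebra: positive linear functionals taking the value `1` at `1`. -/
abbrev State : Type u := {f : A →ₚ[ℂ] ℂ // f 1 = 1}

/-- The Hilbert space of the universal representation: the Hilbert space direct sum, over all
states `f` of `A`, of the GNS spaces of `f`. -/
def UniversalSpace : Type u := lp (fun f : State A => f.1.GNS) 2

instance : NormedAddCommGroup (UniversalSpace A) :=
  inferInstanceAs (NormedAddCommGroup (lp (fun f : State A => f.1.GNS) 2))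

instance : InnerProductSpace ℂ (UniversalSpace A) :=
  inferInstanceAs (InnerProductSpace ℂ (lp (fun f : State A => f.1.GNS) 2))

instance : CompleteSpace (UniversalSpace A) :=
  inferInstanceAs (CompleteSpace (lp (fun f : State A => f.1.GNS) 2))

/-- The operator `⨁ π_f(a)` on the universal Hilbert space, where `π_f` is the GNS representation
of the state `f`. -/
def universalOp (a : A) : UniversalSpace A →L[ℂ] UniversalSpace A :=
  lp.mapCLM (E := fun f : State A => f.1.GNS) (F := fun f : State A => f.1.GNS) 2
    (fun f : State A => f.1.gnsStarAlgHom a) (norm_nonneg a)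
    (fun f => NonUnitalStarAlgHom.norm_apply_le f.1.gnsStarAlgHom a)

variable {A}

/-- The `f`-th component of a vector in the universal Hilbert space. -/
def UniversalSpace.comp (x : UniversalSpace A) (f : State A) : f.1.GNS :=
  (show lp (fun f : State A => f.1.GNS) 2 from x) f

theorem UniversalSpace.ext {x y : UniversalSpace A} (h : ∀ f, x.comp f = y.comp f) : x = y :=
  lp.ext (funext h)

theorem universalOp_comp (a : A) (x : UniversalSpace A) (f : State A) :
    (universalOp A a x).comp f = f.1.gnsStarAlgHom a (x.comp f) := rfl

theorem UniversalSpace.inner_eq_tsum (x y : UniversalSpace A) :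
    inner ℂ x y = ∑' f : State A, inner ℂ (x.comp f) (y.comp f) := rfl

variable (A)

/-- The universal representation `a ↦ ⨁ π_f(a)` of `A`: the direct sum over all states `f` of the
GNS representations `π_f`. -/
def universalRep : A →⋆ₐ[ℂ] (UniversalSpace A →L[ℂ] UniversalSpace A) where
  toFun a := universalOp A a
  map_one' := ContinuousLinearMap.ext fun x => UniversalSpace.ext fun f => by
    rw [universalOp_comp, map_one]; rfl
  map_mul' a b := ContinuousLinearMap.ext fun x => UniversalSpace.ext fun f => by
    rw [universalOp_comp, map_mul]; rfl
  map_zero' := ContinuousLinearMap.ext fun x => UniversalSpace.ext fun f => by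
    rw [universalOp_comp, map_zero]; rfl
  map_add' a b := ContinuousLinearMap.ext fun x => UniversalSpace.ext fun f => by
    rw [universalOp_comp, map_add]; rfl
  commutes' r := ContinuousLinearMap.ext fun x => UniversalSpace.ext fun f => by
    rw [universalOp_comp, Algebra.algebraMap_eq_smul_one, Algebra.algebraMap_eq_smul_one,
      map_smul, map_one]
    rfl
  map_star' a := by
    refine (ContinuousLinearMap.eq_adjoint_iff _ _).mpr fun x y => ?_
    rw [UniversalSpace.inner_eq_tsum, UniversalSpace.inner_eq_tsum]
    refine tsum_congr fun f => ?_
    rw [universalOp_comp, universalOp_comp, map_star, ContinuousLinearMap.star_eq_adjoint,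
      ContinuousLinearMap.adjoint_inner_left]

/-- The double dual `A⋆⋆` of `A` as a C⋆-algebra (indeed a von Neumann algebra): the enveloping
von Neumann algebra of `A`, that is, the double commutant of the image of `A` under its universal
representation. -/
abbrev Bidual : Type u := bicommutant (universalRep A)

/-- The canonical embedding of `A` into `A⋆⋆`. -/
abbrev toBidual : A →⋆ₐ[ℂ] Bidual A := toBicommutant (universalRep A)

end Bidual

/-- Let the injective ⋆-homomorphism `ι : A → B` exhibit `A` as a unital C⋆-subalgebra of `B`. Then
`A` is relatively weakly injective in `B` if there is a weak conditional expectation, i.e. a unital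
completely positive map `φ : B → A⋆⋆` whose restriction to `A` is the canonical embedding of `A`
into `A⋆⋆`. All C⋆-algebras carry their usual order, given by the positive elements. -/
def IsRelativelyWeaklyInjective {A : Type u} {B : Type v} [CStarAlgebra A] [CStarAlgebra B]
    (ι : A →⋆ₐ[ℂ] B) : Prop :=
  letI := CStarAlgebra.spectralOrder A
  letI := CStarAlgebra.spectralOrderedRing A
  letI := CStarAlgebra.spectralOrder B
  letI := CStarAlgebra.spectralOrderedRing B
  letI := CStarAlgebra.spectralOrder (Bidual A)
  letI := CStarAlgebra.spectralOrderedRing (Bidual A)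
  ∃ φ : CompletelyPositiveMap B (Bidual A), φ 1 = 1 ∧ ∀ a : A, φ (ι a) = toBidual A a

/-- A unital C⋆-algebra has the weak expectation property (WEP) if it is relatively weakly
injective in every C⋆-algebra that contains it as a unital C⋆-subalgebra. The containing algebras
live in a universe at least as large as that of `A`. -/
def HasWEP (A : Type u) [CStarAlgebra A] : Prop :=
  ∀ (B : Type (max u v)) [CStarAlgebra B] (ι : A →⋆ₐ[ℂ] B), Function.Injective ι →
    IsRelativelyWeaklyInjective ι

end CStarWEP

end

/-! The weak expectation property passes from small subalgebras to the whole algebra. Let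
`ι : A → B` be an embedding, and for each finite `F ⊆ A` pick `C ⊆ A` with WEP containing `F`. The
inclusion `C → A` extends to `C⋆⋆ → A⋆⋆`, so a weak expectation `B → C⋆⋆` becomes a unital
completely positive map `B → A⋆⋆` that fixes `F`. The limit of these maps along an ultrafilter,
taken pointwise in the weak operator topology, is unital, fixes all of `A`, and is completely
positive because positivity of a matrix of operators is tested by quadratic forms.

The extension to biduals rests on the GNS construction: every vector of a representation `ρ` of `C`
has the form `V ξ` for an intertwiner `V` from the universal representation `π`. An operator
`T ∈ π(C)''` then acts on the space of `ρ` by `V ξ ↦ V (T ξ)`. Since `T` commutes with all `W† V`,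
this operation and the one given by `T†` are formally adjoint to each other, which makes it well
defined and, by the Hellinger–Toeplitz theorem, bounded. -/

noncomputable section

namespace CStarWEP

open Filter
open scoped InnerProduct InnerProductSpace Topology

section HellingerToeplitz

variable {𝕜 E F : Type*} [RCLike 𝕜] [NormedAddCommGroup E] [InnerProductSpace 𝕜 E]
  [CompleteSpace E] [NormedAddCommGroup F] [InnerProductSpace 𝕜 F] [CompleteSpace F]

theorem exists_continuousLinearMap_of_inner_eq {f : E → F} {g : F → E}
    (h : ∀ x y, ⟪f x, y⟫_𝕜 = ⟪x, g y⟫_𝕜) : ∃ T : E →L[𝕜] F, ⇑T = f := by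
  let T : E →ₗ[𝕜] F :=
    { toFun := f
      map_add' x x' := ext_inner_right 𝕜 fun y => by simp only [inner_add_left, h]
      map_smul' c x := ext_inner_right 𝕜 fun y => by
        simp only [inner_smul_left, h, RingHom.id_apply] }
  refine ⟨⟨T, T.continuous_of_seq_closed_graph fun u x z hu hz => ?_⟩, rfl⟩
  refine ext_inner_right 𝕜 fun y => tendsto_nhds_unique (hz.inner tendsto_const_nhds) ?_
  change Tendsto (fun n => ⟪f (u n), y⟫_𝕜) atTop (𝓝 ⟪f x, y⟫_𝕜)
  simp only [h]
  exact hu.inner tendsto_const_nhds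

end HellingerToeplitz

section Intertwiners

variable {A H K L : Type*} [CStarAlgebra A]
  [NormedAddCommGroup H] [InnerProductSpace ℂ H] [CompleteSpace H]
  [NormedAddCommGroup K] [InnerProductSpace ℂ K] [CompleteSpace K]
  [NormedAddCommGroup L] [InnerProductSpace ℂ L] [CompleteSpace L]
  {π : A →⋆ₐ[ℂ] (H →L[ℂ] H)} {ρ : A →⋆ₐ[ℂ] (K →L[ℂ] K)} {σ : A →⋆ₐ[ℂ] (L →L[ℂ] L)}

/-- `V` is an intertwiner from the representation `π` to the representation `ρ`. -/
def Intertwines (π : A →⋆ₐ[ℂ] (H →L[ℂ] H)) (ρ : A →⋆ₐ[ℂ] (K →L[ℂ] K)) (V : H →L[ℂ] K) : Prop :=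
  ∀ a, V ∘L π a = ρ a ∘L V

theorem Intertwines.adjoint {V : H →L[ℂ] K} (hV : Intertwines π ρ V) : Intertwines ρ π (V†) := by
  intro a
  have h := congrArg ContinuousLinearMap.adjoint (hV (star a))
  simpa only [ContinuousLinearMap.adjoint_comp, map_star, ContinuousLinearMap.star_eq_adjoint,
    ContinuousLinearMap.adjoint_adjoint] using h.symm

theorem Intertwines.comp {W : K →L[ℂ] L} {V : H →L[ℂ] K} (hW : Intertwines ρ σ W)
    (hV : Intertwines π ρ V) : Intertwines π σ (W ∘L V) := fun a => by
  rw [ContinuousLinearMap.comp_assoc, hV a, ← ContinuousLinearMap.comp_assoc, hW a,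
    ContinuousLinearMap.comp_assoc]

theorem mem_centralizer_range_iff {S : H →L[ℂ] H} :
    S ∈ StarSubalgebra.centralizer ℂ (Set.range π) ↔ Intertwines π π S := by
  rw [StarSubalgebra.mem_centralizer_iff, Set.forall_mem_range]
  refine ⟨fun h a => (h a).1.symm, fun h a => ⟨(h a).symm, ?_⟩⟩
  rw [← map_star]
  exact (h (star a)).symm

theorem mem_bicommutant_iff {T : H →L[ℂ] H} :
    T ∈ bicommutant π ↔ ∀ S, Intertwines π π S → S * T = T * S := by
  rw [bicommutant, StarSubalgebra.mem_centralizer_iff]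
  simp only [SetLike.mem_coe, mem_centralizer_range_iff]
  exact ⟨fun h S hS => (h S hS).1, fun h S hS => ⟨h S hS, h _ hS.adjoint⟩⟩

theorem Intertwines.inner_apply_of_mem_bicommutant {V W : H →L[ℂ] K} (hV : Intertwines π ρ V)
    (hW : Intertwines π ρ W) {T : H →L[ℂ] H} (hT : T ∈ bicommutant π) (ξ η : H) :
    ⟪V (T ξ), W η⟫_ℂ = ⟪V ξ, W ((T†) η)⟫_ℂ := by
  have hcomm : (W†) (V (T ξ)) = T ((W†) (V ξ)) :=
    DFunLike.congr_fun (mem_bicommutant_iff.mp hT _ (hW.adjoint.comp hV)) ξ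
  rw [← ContinuousLinearMap.adjoint_inner_left W, hcomm,
    ← ContinuousLinearMap.adjoint_inner_right T, ContinuousLinearMap.adjoint_inner_left W]

/-- Every vector of the representation `ρ` lies in the range of an intertwiner from `π`. This is
the property of `π` that makes `ρ` extend from `A` to `π(A)''`. -/
def IntertwinersCover (π : A →⋆ₐ[ℂ] (H →L[ℂ] H)) (ρ : A →⋆ₐ[ℂ] (K →L[ℂ] K)) : Prop :=
  ∀ y : K, ∃ V ξ, Intertwines π ρ V ∧ V ξ = y

namespace IntertwinersCover

variable (h : IntertwinersCover π ρ)
include h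

theorem ext {S T : K →L[ℂ] K} (hST : ∀ V ξ, Intertwines π ρ V → S (V ξ) = T (V ξ)) : S = T := by
  ext y
  obtain ⟨V, ξ, hV, rfl⟩ := h y
  exact hST V ξ hV

theorem exists_extension (T : bicommutant π) :
    ∃ S : K →L[ℂ] K, ∀ V ξ, Intertwines π ρ V → S (V ξ) = V (T.1 ξ) := by
  choose V ξ hV hVξ using h
  have hinner : ∀ x y, ⟪V x (T.1 (ξ x)), y⟫_ℂ = ⟪x, V y ((T.1†) (ξ y))⟫_ℂ := fun x y => by
    simpa only [hVξ] using (hV x).inner_apply_of_mem_bicommutant (hV y) T.2 (ξ x) (ξ y)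
  obtain ⟨S, hS⟩ := exists_continuousLinearMap_of_inner_eq hinner
  refine ⟨S, fun W η hW => ext_inner_right ℂ fun y => ?_⟩
  rw [hS, hinner]
  simpa only [hVξ] using (hW.inner_apply_of_mem_bicommutant (hV y) T.2 η (ξ y)).symm

/-- The operator that the extension of `ρ` to `π(A)''` assigns to `T`. -/
def extensionOp (T : bicommutant π) : K →L[ℂ] K :=
  (h.exists_extension T).choose

theorem extensionOp_apply (T : bicommutant π) {V : H →L[ℂ] K} (hV : Intertwines π ρ V) (ξ : H) :
    h.extensionOp T (V ξ) = V (T.1 ξ) :=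
  (h.exists_extension T).choose_spec V ξ hV

theorem extensionOp_mem_bicommutant (T : bicommutant π) :
    h.extensionOp T ∈ bicommutant ρ := by
  refine mem_bicommutant_iff.mpr fun R hR => h.ext fun V ξ hV => ?_
  calc R (h.extensionOp T (V ξ))
      = (R ∘L V) (T.1 ξ) := congrArg R (h.extensionOp_apply T hV ξ)
    _ = h.extensionOp T ((R ∘L V) ξ) := (h.extensionOp_apply T (hR.comp hV) ξ).symm

theorem extensionOp_star (T : bicommutant π) :
    h.extensionOp (star T) = star (h.extensionOp T) := by
  rw [ContinuousLinearMap.star_eq_adjoint, ContinuousLinearMap.eq_adjoint_iff]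
  intro x y
  obtain ⟨V, ξ, hV, rfl⟩ := h x
  obtain ⟨W, η, hW, rfl⟩ := h y
  rw [h.extensionOp_apply _ hV, h.extensionOp_apply _ hW,
    hV.inner_apply_of_mem_bicommutant hW (star T).2]
  exact congrArg (fun S : H →L[ℂ] H => ⟪V ξ, W (S η)⟫_ℂ) (star_star T.1)

/-- The extension of `ρ` to a ⋆-homomorphism `π(A)'' → ρ(A)''`. -/
def extension : bicommutant π →⋆ₐ[ℂ] bicommutant ρ where
  toFun T := ⟨h.extensionOp T, h.extensionOp_mem_bicommutant T⟩
  map_one' := Subtype.ext <| h.ext fun _ ξ hV => h.extensionOp_apply 1 hV ξ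
  map_mul' S T := Subtype.ext <| h.ext fun V ξ hV => by
    change _ = h.extensionOp S (h.extensionOp T (V ξ))
    simp only [h.extensionOp_apply _ hV]
    rfl
  map_zero' := Subtype.ext <| h.ext fun V ξ hV =>
    (h.extensionOp_apply 0 hV ξ).trans (map_zero V)
  map_add' S T := Subtype.ext <| h.ext fun V ξ hV => by
    change _ = h.extensionOp S (V ξ) + h.extensionOp T (V ξ)
    simp only [h.extensionOp_apply _ hV, ← map_add]
    rfl
  commutes' r := Subtype.ext <| h.ext fun V ξ hV =>
    (h.extensionOp_apply _ hV ξ).trans (map_smul V r ξ)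
  map_star' T := Subtype.ext <| h.extensionOp_star T

theorem extension_toBicommutant (a : A) :
    h.extension (toBicommutant π a) = toBicommutant ρ a :=
  Subtype.ext <| h.ext fun _ ξ hV =>
    (h.extensionOp_apply _ hV ξ).trans (DFunLike.congr_fun (hV a) ξ)

end IntertwinersCover

end Intertwiners

section GNS

variable {A H : Type*} [CStarAlgebra A] [NormedAddCommGroup H] [InnerProductSpace ℂ H]
  [CompleteSpace H]

theorem inner_map_star_mul (π : A →⋆ₐ[ℂ] (H →L[ℂ] H)) (a b : A) (x y : H) :
    ⟪x, π (star a * b) y⟫_ℂ = ⟪π a x, π b y⟫_ℂ := by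
  rw [map_mul, map_star, ContinuousLinearMap.star_eq_adjoint, mul_apply_eq_comp,
    ContinuousLinearMap.adjoint_inner_right]

variable [PartialOrder A] [StarOrderedRing A]

/-- The positive functional `a ↦ ⟪x, π a x⟫` on `A`. -/
def vectorFunctional (π : A →⋆ₐ[ℂ] (H →L[ℂ] H)) (x : H) : A →ₚ[ℂ] ℂ :=
  PositiveLinearMap.mk₀
    { toFun a := ⟪x, π a x⟫_ℂ
      map_add' a b := by simp
      map_smul' c a := by simp }
    (fun a ha => by
      obtain ⟨b, rfl⟩ := CStarAlgebra.nonneg_iff_eq_star_mul_self.mp ha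
      change 0 ≤ ⟪x, π (star b * b) x⟫_ℂ
      rw [inner_map_star_mul, inner_self_eq_norm_sq_to_K]
      positivity)

theorem vectorFunctional_apply (π : A →⋆ₐ[ℂ] (H →L[ℂ] H)) (x : H) (a : A) :
    vectorFunctional π x a = ⟪x, π a x⟫_ℂ := rfl

/-- The isometry `a ↦ π a x` from the pre-GNS space of the vector functional of `x`. -/
def preGNSOrbitMap (π : A →⋆ₐ[ℂ] (H →L[ℂ] H)) (x : H) :
    (vectorFunctional π x).PreGNS →ₗᵢ[ℂ] H where
  toFun a := π ((vectorFunctional π x).ofPreGNS a) x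
  map_add' a b := by simp
  map_smul' c a := by simp
  norm_map' a := by
    rw [PositiveLinearMap.preGNS_norm_def, vectorFunctional_apply, inner_map_star_mul,
      @norm_eq_sqrt_re_inner ℂ]
    rfl

/-- The map from the GNS space of the vector functional of `x` onto the cyclic subspace
generated by `x`. -/
def gnsOrbitMap (π : A →⋆ₐ[ℂ] (H →L[ℂ] H)) (x : H) : (vectorFunctional π x).GNS →L[ℂ] H :=
  (preGNSOrbitMap π x).toContinuousLinearMap.fromCompletion

theorem gnsOrbitMap_coe (π : A →⋆ₐ[ℂ] (H →L[ℂ] H)) (x : H)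
    (a : (vectorFunctional π x).PreGNS) :
    gnsOrbitMap π x a = π ((vectorFunctional π x).ofPreGNS a) x :=
  ContinuousLinearMap.fromCompletion_apply_coe _ a

theorem intertwines_gnsOrbitMap (π : A →⋆ₐ[ℂ] (H →L[ℂ] H)) (x : H) :
    Intertwines (vectorFunctional π x).gnsStarAlgHom π (gnsOrbitMap π x) := by
  intro c
  ext y
  induction y using UniformSpace.Completion.induction_on with
  | hp => exact isClosed_eq (by fun_prop) (by fun_prop)
  | ih a =>
    calc gnsOrbitMap π x ((vectorFunctional π x).gnsStarAlgHom c a)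
        = gnsOrbitMap π x ((vectorFunctional π x).leftMulMapPreGNS c a) :=
          congrArg _ (PositiveLinearMap.gnsNonUnitalStarAlgHom_apply_coe _)
      _ = π c (gnsOrbitMap π x a) := by
          simp [gnsOrbitMap_coe]

end GNS

section UniversalRepresentation

variable {A : Type u} [CStarAlgebra A] [PartialOrder A] [StarOrderedRing A]
  {H : Type*} [NormedAddCommGroup H] [InnerProductSpace ℂ H] [CompleteSpace H]

/-- The projection of the universal space onto the GNS space of a state. -/
def UniversalSpace.proj (f : State A) : UniversalSpace A →L[ℂ] f.1.GNS :=
  lp.evalCLM ℂ (fun f : State A => f.1.GNS) 2 f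

theorem UniversalSpace.proj_surjective (f : State A) : Function.Surjective (proj f) := fun x => by
  classical
  exact ⟨lp.singleContinuousLinearMap ℂ (fun f : State A => f.1.GNS) 2 f x,
    lp.single_apply_self (E := fun f : State A => f.1.GNS) 2 f x⟩

theorem UniversalSpace.intertwines_proj (f : State A) :
    Intertwines (universalRep A) f.1.gnsStarAlgHom (proj f) := fun _ => rfl

theorem exists_intertwines_apply_eq_of_norm_eq_one (π : A →⋆ₐ[ℂ] (H →L[ℂ] H)) {x : H}
    (hx : ‖x‖ = 1) : ∃ V ξ, Intertwines (universalRep A) π V ∧ V ξ = x := by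
  let f : State A := ⟨vectorFunctional π x, by simp [vectorFunctional_apply, hx]⟩
  obtain ⟨ξ, hξ⟩ := UniversalSpace.proj_surjective f (f.1.toPreGNS 1 : f.1.PreGNS)
  refine ⟨gnsOrbitMap π x ∘L UniversalSpace.proj f, ξ,
    (intertwines_gnsOrbitMap π x).comp (UniversalSpace.intertwines_proj f), ?_⟩
  calc gnsOrbitMap π x (UniversalSpace.proj f ξ) = π 1 x :=
        (congrArg _ hξ).trans (gnsOrbitMap_coe π x _)
    _ = x := by rw [map_one, one_apply_eq_self]

theorem intertwinersCover_universalRep (π : A →⋆ₐ[ℂ] (H →L[ℂ] H)) :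
    IntertwinersCover (universalRep A) π := by
  intro x
  rcases eq_or_ne x 0 with rfl | hx
  · exact ⟨0, 0, fun _ => by simp, map_zero _⟩
  · obtain ⟨V, ξ, hV, hξ⟩ :=
      exists_intertwines_apply_eq_of_norm_eq_one π (norm_smul_inv_norm (𝕜 := ℂ) hx)
    refine ⟨V, (‖x‖ : ℂ) • ξ, hV, ?_⟩
    rw [map_smul, hξ]
    exact smul_inv_smul₀ (by simpa using hx) x

end UniversalRepresentation

section BidualMap

theorem bicommutant_comp_le {A C H : Type*} [CStarAlgebra A] [CStarAlgebra C]
    [NormedAddCommGroup H] [InnerProductSpace ℂ H] [CompleteSpace H]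
    (π : A →⋆ₐ[ℂ] (H →L[ℂ] H)) (j : C →⋆ₐ[ℂ] A) :
    bicommutant (π.comp j) ≤ bicommutant π :=
  fun _ hT => mem_bicommutant_iff.mpr fun S hS => mem_bicommutant_iff.mp hT S fun c => hS (j c)

variable {C : Type u} {A : Type v} [CStarAlgebra C] [PartialOrder C] [StarOrderedRing C]
  [CStarAlgebra A] [PartialOrder A] [StarOrderedRing A]

/-- The ⋆-homomorphism `C⋆⋆ → A⋆⋆` extending a ⋆-homomorphism `C → A`. -/
def bidualMap (j : C →⋆ₐ[ℂ] A) : Bidual C →⋆ₐ[ℂ] Bidual A :=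
  (StarSubalgebra.inclusion (bicommutant_comp_le (universalRep A) j)).comp
    (intertwinersCover_universalRep ((universalRep A).comp j)).extension

theorem bidualMap_toBidual (j : C →⋆ₐ[ℂ] A) (c : C) :
    bidualMap j (toBidual C c) = toBidual A (j c) :=
  congrArg (StarSubalgebra.inclusion (bicommutant_comp_le (universalRep A) j))
    (IntertwinersCover.extension_toBicommutant _ c)

end BidualMap

section MatrixPositivity

theorem nonneg_of_map_nonneg {D E : Type*} [CStarAlgebra D] [PartialOrder D] [StarOrderedRing D]
    [CStarAlgebra E] [PartialOrder E] [StarOrderedRing E] {φ : D →⋆ₐ[ℂ] E}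
    (hφ : Function.Injective φ) {a : D} (ha : 0 ≤ φ a) : 0 ≤ a := by
  have hsa : IsSelfAdjoint a := hφ ((map_star φ a).trans (IsSelfAdjoint.of_nonneg ha).star_eq)
  rw [StarOrderedRing.nonneg_iff_spectrum_nonneg (R := ℝ) (φ a) (hsa.map φ),
    hsa.map_spectrum_real φ hφ] at ha
  exact (StarOrderedRing.nonneg_iff_spectrum_nonneg (R := ℝ) a hsa).mpr ha

theorem nonneg_iff_inner_nonneg_right {H : Type*} [NormedAddCommGroup H] [InnerProductSpace ℂ H]
    {T : H →L[ℂ] H} : 0 ≤ T ↔ ∀ x, 0 ≤ ⟪x, T x⟫_ℂ := by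
  rw [ContinuousLinearMap.nonneg_iff_isPositive]
  refine ⟨fun h => h.inner_nonneg_right, fun h => ?_⟩
  have hflip x : ⟪T x, x⟫_ℂ = ⟪x, T x⟫_ℂ := by
    rw [← inner_conj_symm, Complex.conj_eq_iff_im.mpr (Complex.nonneg_iff.mp (h x)).2.symm]
  exact (T.isPositive_iff_complex).mpr fun x => by
    rw [hflip]
    exact ⟨Complex.ext rfl (Complex.nonneg_iff.mp (h x)).2, (Complex.nonneg_iff.mp (h x)).1⟩

variable {D H n : Type*} [CStarAlgebra D] [NormedAddCommGroup H] [InnerProductSpace ℂ H]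
  [CompleteSpace H] [Fintype n]

/-- The operator on `Hⁿ` given by the image under `ρ` of a matrix over `D`. -/
def matrixOp (ρ : D →⋆ₐ[ℂ] (H →L[ℂ] H)) (M : CStarMatrix n n D) :
    PiLp 2 (fun _ : n => H) →L[ℂ] PiLp 2 (fun _ : n => H) :=
  (PiLp.continuousLinearEquiv 2 ℂ (fun _ : n => H)).symm.toContinuousLinearMap.comp
    (ContinuousLinearMap.pi fun i => ∑ j, (ρ (M i j)).comp (PiLp.proj 2 (fun _ : n => H) j))

theorem matrixOp_apply (ρ : D →⋆ₐ[ℂ] (H →L[ℂ] H)) (M : CStarMatrix n n D)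
    (x : PiLp 2 (fun _ : n => H)) (i : n) : matrixOp ρ M x i = ∑ j, ρ (M i j) (x j) := by
  simp [matrixOp]

/-- The amplification of a representation of `D` on `H` to a representation of the matrix algebra
over `D` on `Hⁿ`. -/
def matrixRep [DecidableEq n] (ρ : D →⋆ₐ[ℂ] (H →L[ℂ] H)) :
    CStarMatrix n n D →⋆ₐ[ℂ] (PiLp 2 (fun _ : n => H) →L[ℂ] PiLp 2 (fun _ : n => H)) where
  toFun := matrixOp ρ
  map_one' := by
    ext x i
    rw [matrixOp_apply, Finset.sum_eq_single i]
    · simp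
    · intro j _ hj
      simp [CStarMatrix.one_apply_ne hj.symm]
    · simp
  map_mul' M N := by
    ext x i
    change _ = matrixOp ρ M (matrixOp ρ N x) i
    simp only [matrixOp_apply, map_sum, CStarMatrix.mul_apply, map_mul, sum_apply]
    exact Finset.sum_comm
  map_zero' := by
    ext x i
    simp [matrixOp_apply]
  map_add' M N := by
    ext x i
    simp [matrixOp_apply, Finset.sum_add_distrib]
  commutes' r := by
    ext x i
    rw [matrixOp_apply, Finset.sum_eq_single i]
    · simp [CStarMatrix.algebraMap_apply, Algebra.algebraMap_eq_smul_one]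
    · intro j _ hj
      simp [CStarMatrix.algebraMap_apply, hj.symm]
    · simp
  map_star' M := by
    rw [ContinuousLinearMap.star_eq_adjoint, ContinuousLinearMap.eq_adjoint_iff]
    intro x y
    simp only [PiLp.inner_apply, matrixOp_apply, sum_inner, inner_sum, CStarMatrix.star_apply,
      map_star, ContinuousLinearMap.star_eq_adjoint, ContinuousLinearMap.adjoint_inner_left]
    exact Finset.sum_comm

theorem matrixRep_apply [DecidableEq n] (ρ : D →⋆ₐ[ℂ] (H →L[ℂ] H)) (M : CStarMatrix n n D)
    (x : PiLp 2 (fun _ : n => H)) (i : n) : matrixRep ρ M x i = ∑ j, ρ (M i j) (x j) :=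
  matrixOp_apply ρ M x i

theorem matrixRep_injective [DecidableEq n] {ρ : D →⋆ₐ[ℂ] (H →L[ℂ] H)}
    (hρ : Function.Injective ρ) :
    Function.Injective (matrixRep (n := n) ρ) := by
  intro M N hMN
  ext i j
  refine hρ (ContinuousLinearMap.ext fun x => ?_)
  have hentry (P : CStarMatrix n n D) :
      matrixRep ρ P (WithLp.toLp 2 (Pi.single j x)) i = ρ (P i j) x := by
    rw [matrixRep_apply, Finset.sum_eq_single j]
    · simp
    · intro k _ hk
      simp [Pi.single_eq_of_ne hk]
    · simp
  rw [← hentry M, ← hentry N, hMN]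

theorem cstarMatrix_nonneg_iff [PartialOrder D] [StarOrderedRing D] {ρ : D →⋆ₐ[ℂ] (H →L[ℂ] H)}
    (hρ : Function.Injective ρ) (M : CStarMatrix n n D) :
    0 ≤ M ↔ ∀ x : n → H, 0 ≤ ∑ i, ∑ j, ⟪x i, ρ (M i j) (x j)⟫_ℂ := by
  classical
  have hquad (x : PiLp 2 (fun _ : n => H)) :
      ⟪x, matrixRep ρ M x⟫_ℂ = ∑ i, ∑ j, ⟪x i, ρ (M i j) (x j)⟫_ℂ := by
    simp only [PiLp.inner_apply, matrixRep_apply, inner_sum]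
  calc 0 ≤ M ↔ 0 ≤ matrixRep ρ M :=
        ⟨map_nonneg (matrixRep ρ), nonneg_of_map_nonneg (matrixRep_injective hρ)⟩
    _ ↔ ∀ x : PiLp 2 (fun _ : n => H), 0 ≤ ⟪x, matrixRep ρ M x⟫_ℂ :=
        nonneg_iff_inner_nonneg_right
    _ ↔ _ := by
        simp only [hquad]
        exact ⟨fun h x => h (WithLp.toLp 2 x), fun h x => h x⟩

end MatrixPositivity

section WeakLimits

open ContinuousLinearMapWOT

variable {𝕜 E F I : Type*} [RCLike 𝕜] [NormedAddCommGroup E] [InnerProductSpace 𝕜 E]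
  [CompleteSpace E] [NormedAddCommGroup F] [InnerProductSpace 𝕜 F] [CompleteSpace F]

theorem exists_tendsto_inner_of_norm_le (l : Ultrafilter I) {x : I → E} {r : ℝ}
    (hx : ∀ i, ‖x i‖ ≤ r) : ∃ z, ∀ y, Tendsto (fun i => ⟪x i, y⟫_𝕜) l (𝓝 ⟪z, y⟫_𝕜) := by
  let f (i : I) : WeakDual 𝕜 E := StrongDual.toWeakDual (InnerProductSpace.toDual 𝕜 E (x i))
  have hf (i : I) : f i ∈ WeakDual.toStrongDual ⁻¹' Metric.closedBall 0 r := by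
    simpa [f] using hx i
  obtain ⟨g, -, hg⟩ := (WeakDual.isCompact_closedBall (0 : StrongDual 𝕜 E) r).ultrafilter_le_nhds
    (l.map f) (tendsto_principal.mpr (Eventually.of_forall hf))
  refine ⟨(InnerProductSpace.toDual 𝕜 E).symm (WeakDual.toStrongDual g), fun y => ?_⟩
  rw [InnerProductSpace.toDual_symm_apply]
  exact ((WeakDual.eval_continuous y).tendsto g).comp hg

theorem exists_tendsto_wot_of_norm_le (l : Ultrafilter I) {T : I → E →L[𝕜] F} {r : ℝ}
    (hT : ∀ i, ‖T i‖ ≤ r) :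
    ∃ S : E →L[𝕜] F, Tendsto (fun i => ofCLM (T i)) l (𝓝 (ofCLM S)) := by
  have hadj i : ‖(T i)†‖ ≤ r := by simpa using hT i
  choose S hS using fun x => exists_tendsto_inner_of_norm_le (𝕜 := 𝕜) l
    fun i => (T i).le_of_opNorm_le (hT i) x
  choose S' hS' using fun y => exists_tendsto_inner_of_norm_le (𝕜 := 𝕜) l
    fun i => ((T i)†).le_of_opNorm_le (hadj i) y
  have hinner : ∀ x y, ⟪S x, y⟫_𝕜 = ⟪x, S' y⟫_𝕜 := fun x y => by
    refine tendsto_nhds_unique (hS x y) ?_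
    simpa [ContinuousLinearMap.adjoint_inner_left] using (hS' y x).star
  obtain ⟨R, rfl⟩ := exists_continuousLinearMap_of_inner_eq hinner
  refine ⟨R, tendsto_iff_forall_inner_apply_tendsto.mpr fun x y => ?_⟩
  simpa using (hS x y).star

end WeakLimits

section BicommutantClosed

open ContinuousLinearMapWOT

variable {A H : Type*} [CStarAlgebra A] [NormedAddCommGroup H] [InnerProductSpace ℂ H]
  [CompleteSpace H]

theorem isClosed_wot_bicommutant (π : A →⋆ₐ[ℂ] (H →L[ℂ] H)) :
    IsClosed {T : H →WOT[ℂ] H | toCLM T ∈ bicommutant π} := by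
  have hset : {T : H →WOT[ℂ] H | toCLM T ∈ bicommutant π} =
      Set.centralizer (ofCLM '' {S | Intertwines π π S}) := by
    ext T
    simp only [Set.mem_ofPred_eq, mem_bicommutant_iff, Set.mem_centralizer_iff,
      Set.forall_mem_image, ← toCLM_injective.eq_iff, toCLM_mul]
  rw [hset]
  exact Set.isClosed_centralizer _

end BicommutantClosed

section CompletelyPositive

variable {B C D : Type*} [CStarAlgebra B] [PartialOrder B] [StarOrderedRing B]
  [CStarAlgebra C] [PartialOrder C] [StarOrderedRing C]
  [CStarAlgebra D] [PartialOrder D] [StarOrderedRing D]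

/-- The composition of a completely positive map with a ⋆-homomorphism, as a completely positive
map. -/
def starAlgHomCompCP (ρ : C →⋆ₐ[ℂ] D) (φ : CompletelyPositiveMap B C) :
    CompletelyPositiveMap B D where
  toLinearMap := ρ.toAlgHom.toLinearMap ∘ₗ φ.toLinearMap
  map_cstarMatrix_nonneg' k M hM :=
    CompletelyPositiveMapClass.map_cstarMatrix_nonneg' ρ k _ (φ.map_cstarMatrix_nonneg' k M hM)

theorem starAlgHomCompCP_apply (ρ : C →⋆ₐ[ℂ] D) (φ : CompletelyPositiveMap B C) (b : B) :
    starAlgHomCompCP ρ φ b = ρ (φ b) := rfl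

theorem norm_positiveLinearMap_le (f : B →ₚ[ℂ] C) (b : B) : ‖f b‖ ≤ 4 * (‖f 1‖ * ‖b‖) := by
  obtain ⟨y, hy_nonneg, hy_norm, hy⟩ := CStarAlgebra.exists_sum_four_nonneg b
  have hterm (i : Fin 4) : ‖f (Complex.I ^ (i : ℕ) • y i)‖ ≤ ‖f 1‖ * ‖b‖ :=
    calc ‖f (Complex.I ^ (i : ℕ) • y i)‖ = ‖f (y i)‖ := by
          rw [map_smul, norm_smul, norm_pow, Complex.norm_I, one_pow, one_mul]
      _ ≤ ‖f 1‖ * ‖y i‖ := f.norm_apply_le_of_nonneg (y i) (hy_nonneg i)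
      _ ≤ ‖f 1‖ * ‖b‖ := by gcongr; exact hy_norm i
  calc ‖f b‖ = ‖∑ i : Fin 4, f (Complex.I ^ (i : ℕ) • y i)‖ := by rw [← map_sum, ← hy]
    _ ≤ ∑ _i : Fin 4, ‖f 1‖ * ‖b‖ := norm_sum_le_of_le _ fun i _ => hterm i
    _ = 4 * (‖f 1‖ * ‖b‖) := by simp

end CompletelyPositive

section CompletelyPositiveLimit

open ContinuousLinearMapWOT

variable {A B H I : Type*} [CStarAlgebra A] [NormedAddCommGroup H] [InnerProductSpace ℂ H]
  [CompleteSpace H] [CStarAlgebra B] {π : A →⋆ₐ[ℂ] (H →L[ℂ] H)}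

theorem exists_linearMap_tendsto_wot (l : Filter I) [l.NeBot] {φ : I → B →ₗ[ℂ] bicommutant π}
    (hφ : ∀ b, ∃ S : H →L[ℂ] H, Tendsto (fun i => ofCLM (φ i b).1) l (𝓝 (ofCLM S))) :
    ∃ ψ : B →ₗ[ℂ] bicommutant π, ∀ b,
      Tendsto (fun i => ofCLM (φ i b).1) l (𝓝 (ofCLM (ψ b).1)) := by
  choose S hS using hφ
  have hmem b : S b ∈ bicommutant π :=
    (isClosed_wot_bicommutant π).mem_of_tendsto (hS b) (Eventually.of_forall fun i => (φ i b).2)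
  refine ⟨{ toFun b := ⟨S b, hmem b⟩, map_add' b c := ?_, map_smul' r b := ?_ }, hS⟩
  · refine Subtype.ext (ofCLM_injective (tendsto_nhds_unique (hS (b + c)) ?_))
    simpa using (hS b).add (hS c)
  · refine Subtype.ext (ofCLM_injective (tendsto_nhds_unique (hS (r • b)) ?_))
    simpa using (hS b).const_smul r

variable [PartialOrder B] [StarOrderedRing B] [PartialOrder (bicommutant π)]
  [StarOrderedRing (bicommutant π)]

theorem cstarMatrix_map_nonneg_of_tendsto_wot {l : Filter I} [l.NeBot]
    {φ : I → CompletelyPositiveMap B (bicommutant π)} {ψ : B →ₗ[ℂ] bicommutant π}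
    (hψ : ∀ b, Tendsto (fun i => ofCLM (φ i b).1) l (𝓝 (ofCLM (ψ b).1)))
    {n : ℕ} {M : CStarMatrix (Fin n) (Fin n) B} (hM : 0 ≤ M) : 0 ≤ M.map ψ := by
  have hiff := cstarMatrix_nonneg_iff (n := Fin n) (ρ := (bicommutant π).subtype)
    Subtype.val_injective
  refine (hiff _).mpr fun x => ?_
  have hlim : Tendsto (fun i => ∑ a, ∑ b, ⟪x a, (φ i (M a b)).1 (x b)⟫_ℂ) l
      (𝓝 (∑ a, ∑ b, ⟪x a, (ψ (M a b)).1 (x b)⟫_ℂ)) :=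
    tendsto_finsetSum _ fun a _ => tendsto_finsetSum _ fun b _ =>
      tendsto_iff_forall_inner_apply_tendsto.mp (hψ (M a b)) (x b) (x a)
  exact ge_of_tendsto' hlim fun i => (hiff _).mp ((φ i).map_cstarMatrix_nonneg' n M hM) x

theorem exists_completelyPositiveMap_tendsto_wot (l : Ultrafilter I)
    {φ : I → CompletelyPositiveMap B (bicommutant π)} {r : ℝ} (hφ : ∀ i, ‖φ i 1‖ ≤ r) :
    ∃ ψ : CompletelyPositiveMap B (bicommutant π), ∀ b,
      Tendsto (fun i => ofCLM (φ i b).1) l (𝓝 (ofCLM (ψ b).1)) := by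
  have hbound (b : B) (i : I) : ‖(φ i b).1‖ ≤ 4 * (r * ‖b‖) :=
    calc ‖φ i b‖ ≤ 4 * (‖φ i 1‖ * ‖b‖) :=
          norm_positiveLinearMap_le (PositiveLinearMap.ofClass (φ i)) b
      _ ≤ 4 * (r * ‖b‖) := by gcongr; exact hφ i
  obtain ⟨ψ, hψ⟩ := exists_linearMap_tendsto_wot (φ := fun i => (φ i).toLinearMap) l
    fun b => exists_tendsto_wot_of_norm_le l (hbound b)
  exact ⟨⟨ψ, fun _ _ => cstarMatrix_map_nonneg_of_tendsto_wot hψ⟩, hψ⟩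

end CompletelyPositiveLimit

section WeakExpectation

open ContinuousLinearMapWOT

theorem exists_weakExpectation_of_eventually {A B I : Type*}
    [CStarAlgebra A] [PartialOrder A] [StarOrderedRing A]
    [CStarAlgebra B] [PartialOrder B] [StarOrderedRing B]
    [PartialOrder (Bidual A)] [StarOrderedRing (Bidual A)]
    (ι : A →⋆ₐ[ℂ] B) (l : Ultrafilter I) {φ : I → CompletelyPositiveMap B (Bidual A)} {r : ℝ}
    (hφ : ∀ i, ‖φ i 1‖ ≤ r) (h : ∀ a, ∀ᶠ i in l, φ i (ι a) = toBidual A a) :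
    ∃ ψ : CompletelyPositiveMap B (Bidual A), ψ 1 = 1 ∧ ∀ a, ψ (ι a) = toBidual A a := by
  obtain ⟨ψ, hψ⟩ := exists_completelyPositiveMap_tendsto_wot l hφ
  have hfix a : ψ (ι a) = toBidual A a := by
    refine Subtype.ext (ofCLM_injective (tendsto_nhds_unique (hψ (ι a)) ?_))
    exact tendsto_const_nhds.congr' ((h a).mono fun i hi => by simp only [hi])
  exact ⟨ψ, by rw [← map_one ι, hfix, map_one], hfix⟩

theorem exists_completelyPositiveMap_bidual_of_starAlgHom {C A B : Type*}
    [CStarAlgebra C] [PartialOrder C] [StarOrderedRing C]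
    [CStarAlgebra A] [PartialOrder A] [StarOrderedRing A]
    [CStarAlgebra B] [PartialOrder B] [StarOrderedRing B]
    [PartialOrder (Bidual C)] [StarOrderedRing (Bidual C)]
    [PartialOrder (Bidual A)] [StarOrderedRing (Bidual A)] (j : C →⋆ₐ[ℂ] A) {κ : C → B}
    (h : ∃ φ : CompletelyPositiveMap B (Bidual C), φ 1 = 1 ∧ ∀ c, φ (κ c) = toBidual C c) :
    ∃ φ : CompletelyPositiveMap B (Bidual A), φ 1 = 1 ∧ ∀ c, φ (κ c) = toBidual A (j c) := by
  obtain ⟨φ, hφ_one, hφ⟩ := h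
  refine ⟨starAlgHomCompCP (bidualMap j) φ, ?_, fun c => ?_⟩
  · rw [starAlgHomCompCP_apply, hφ_one, map_one]
  · rw [starAlgHomCompCP_apply, hφ, bidualMap_toBidual]

end WeakExpectation

section Separable

theorem countable_submonoidClosure {M : Type*} [Monoid M] {s : Set M} (hs : s.Countable) :
    (Submonoid.closure s : Set M).Countable := by
  have : Countable s := hs
  have : Countable (FreeMonoid s) := inferInstanceAs (Countable (List s))
  rw [Submonoid.closure_eq_mrange]
  exact Set.countable_range _

theorem separableSpace_topologicalClosure_adjoin {A : Type*} [CStarAlgebra A] {s : Set A}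
    (hs : s.Countable) :
    TopologicalSpace.SeparableSpace (StarAlgebra.adjoin ℂ s).topologicalClosure := by
  have hstar : (star s).Countable := by simpa only [Set.image_star] using hs.image star
  have hspan : TopologicalSpace.IsSeparable (StarAlgebra.adjoin ℂ s : Set A) := by
    have := (countable_submonoidClosure (hs.union hstar)).isSeparable.span (R := ℂ)
    rwa [← StarAlgebra.adjoin_eq_span] at this
  exact hspan.closure.separableSpace

end Separable

end CStarWEP

end

theorem mainTheorem7_general {A : Type u} [CStarAlgebra A]
    (h : ∀ F : Finset A, ∃ (C : StarSubalgebra ℂ A) (_ : IsClosed (C : Set A)),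
      (F : Set A) ⊆ C ∧ CStarWEP.HasWEP.{u, v} C) : CStarWEP.HasWEP.{u, v} A := by
  classical
  intro B _ ι hι
  let := CStarAlgebra.spectralOrder A
  let := CStarAlgebra.spectralOrderedRing A
  let := CStarAlgebra.spectralOrder B
  let := CStarAlgebra.spectralOrderedRing B
  let := CStarAlgebra.spectralOrder (CStarWEP.Bidual A)
  let := CStarAlgebra.spectralOrderedRing (CStarWEP.Bidual A)
  have hexp (F : Finset A) : ∃ φ : CompletelyPositiveMap B (CStarWEP.Bidual A),
      φ 1 = 1 ∧ ∀ a ∈ F, φ (ι a) = CStarWEP.toBidual A a := by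
    obtain ⟨C, hclosed, hFC, hC⟩ := h F
    let := CStarAlgebra.spectralOrder C
    let := CStarAlgebra.spectralOrderedRing C
    let := CStarAlgebra.spectralOrder (CStarWEP.Bidual C)
    let := CStarAlgebra.spectralOrderedRing (CStarWEP.Bidual C)
    obtain ⟨φ, hφ_one, hφ⟩ := CStarWEP.exists_completelyPositiveMap_bidual_of_starAlgHom C.subtype
      (hC B (ι.comp C.subtype) (hι.comp Subtype.val_injective))
    exact ⟨φ, hφ_one, fun a ha => hφ ⟨a, hFC ha⟩⟩
  choose φ hφ_one hφ using hexp
  refine CStarWEP.exists_weakExpectation_of_eventually ι (Ultrafilter.of Filter.atTop)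
    (fun F => (congrArg norm (hφ_one F)).le) fun a => Ultrafilter.of_le _ ?_
  filter_upwards [Filter.eventually_ge_atTop {a}] with F hF
  exact hφ F a (hF (Finset.mem_singleton_self a))

theorem mainTheorem7 {A : Type u} [CStarAlgebra A]
    (hA : ¬ TopologicalSpace.SeparableSpace A)
    (𝒞 : Set (StarSubalgebra ℂ A))
    (hclosed : ∀ C ∈ 𝒞, IsClosed (C : Set A))
    (hsep : ∀ C ∈ 𝒞, TopologicalSpace.SeparableSpace C)
    (hcofinal : ∀ S : StarSubalgebra ℂ A, IsClosed (S : Set A) →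
      TopologicalSpace.SeparableSpace S → ∃ C ∈ 𝒞, S ≤ C)
    (hWEP : ∀ (C : StarSubalgebra ℂ A) (hC : C ∈ 𝒞),
      haveI : IsClosed (C : Set A) := hclosed C hC
      CStarWEP.HasWEP.{u, v} C) :
    CStarWEP.HasWEP.{u, v} A := by
  refine mainTheorem7_general fun F => ?_
  obtain ⟨C, hC, hFC⟩ := hcofinal (StarAlgebra.adjoin ℂ (F : Set A)).topologicalClosure
    (StarSubalgebra.isClosed_topologicalClosure _)
    (CStarWEP.separableSpace_topologicalClosure_adjoin F.countable_toSet)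
  exact ⟨C, hclosed C hC, (StarAlgebra.subset_adjoin ℂ _).trans
    ((StarSubalgebra.le_topologicalClosure _).trans hFC), hWEP C hC⟩
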